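/- Let $d,T\ge 1$ be integers, let $\mathbb B=\{w\in\mathbb R^d:\|w\|_2\le 1\}$, and let $\Omega\subseteq\mathbb R^d$ be a closed convex set with $R_1\mathbb B\subseteq\Omega\subseteq R_2\mathbb B$, where $R_1>0$. Let $f_1,\dots,f_T:\mathbb R^d\to\mathbb R$ be functions that are convex and $G$-Lipschitz (with respect to $\|\cdot\|_2$, $G>0$) on $\Omega$. Let $\Omega_t^*$ be the set of all minimizers of $f_t$ over $\Omega$. Assume that $r>0$ satisfies $\|w-w^*\|_2\le r$ for all $w\in\Omega$, $w^*\in\Omega_t^*$ and $1\le t\le T$, and that the path variation is at most $B_T$: $$V_T^p=\max_{w_t^*\in\Omega_t^*,\ 1\le t\le T}\ \sum_{t=1}^{T-1}\|w_t^*-w_{t+1}^*\|_2\le B_T .$$ Let $u_1,\dots,u_T$ be independent random vectors, each uniformly distributed on the unit sphere of $\mathbb R^d$. Put $$\xi=\frac1T,\qquad \delta=\xi R_1,\qquad \eta=\sqrt{\frac{r^2+2rB_T}{TG^2d^2}},$$ and define $w_1=0$ and $$w_{t+1}=\Pi_{(1-\xi)\Omega}\big[w_t-\eta\,\hat g_t\big],\qquad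 \hat g_t=\frac{d}{2\delta}\big[f_t(w_t+\delta u_t)-f_t(w_t-\delta u_t)\big]u_t ,$$ where $\Pi_{(1-\xi)\Omega}$ is the Euclidean projection onto $(1-\xi)\Omega$. Then for any choice of minimizers $w_t^*\in\Omega_t^*$, $1\le t\le T$, the following expectation exists and $$\mathrm E\left[\sum_{t=1}^T\tfrac12\big(f_t(w_t+\delta u_t)+f_t(w_t-\delta u_t)\big)\right]-\sum_{t=1}^T f_t(w_t^*)\ \le\ \sqrt{(r^2+2rB_T)G^2d^2T}+G(3R_1+R_2).$$ -/

import Mathlib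

open MeasureTheory ProbabilityTheory
open scoped NNReal Pointwise

namespace BanditOGD

/-- The set of minimizers of the loss `f` over the decision set `K`. -/
def minimizers {d : ℕ} (K : Set (EuclideanSpace ℝ (Fin d)))
    (f : EuclideanSpace ℝ (Fin d) → ℝ) : Set (EuclideanSpace ℝ (Fin d)) :=
  {w | w ∈ K ∧ ∀ z ∈ K, f w ≤ f z}

/-- The path variation of the losses `f 1, …, f T` over `K`: the supremum of
`∑_{t=1}^{T-1} ‖w t - w (t+1)‖` over all selections of minimizers `w 1, …, w T`. -/
noncomputable def pathVariation {d : ℕ} (K : Set (EuclideanSpace ℝ (Fin d)))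
    (f : ℕ → EuclideanSpace ℝ (Fin d) → ℝ) (T : ℕ) : ℝ :=
  sSup {v | ∃ w : ℕ → EuclideanSpace ℝ (Fin d),
    (∀ t ∈ Finset.Icc 1 T, w t ∈ minimizers K (f t)) ∧
    v = ∑ t ∈ Finset.Ico 1 T, ‖w t - w (t + 1)‖}

/-- `y` is a point of `K` nearest to `x`. -/
def IsNearest {d : ℕ} (K : Set (EuclideanSpace ℝ (Fin d)))
    (x y : EuclideanSpace ℝ (Fin d)) : Prop :=
  y ∈ K ∧ ∀ z ∈ K, ‖x - y‖ ≤ ‖x - z‖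

/-- The Euclidean projection onto `K` (a nearest point, which exists for `K` closed and nonempty
and is unique for `K` convex). -/
noncomputable def proj {d : ℕ} (K : Set (EuclideanSpace ℝ (Fin d)))
    (x : EuclideanSpace ℝ (Fin d)) : EuclideanSpace ℝ (Fin d) :=
  Classical.epsilon (IsNearest K x)

theorem isNearest_proj {d : ℕ} {K : Set (EuclideanSpace ℝ (Fin d))} (hK : IsClosed K)
    (hne : K.Nonempty) (x : EuclideanSpace ℝ (Fin d)) : IsNearest K x (proj K x) := by
  apply Classical.epsilon_spec (p := IsNearest K x)
  obtain ⟨y, hy, h⟩ := hK.exists_infDist_eq_dist hne x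
  refine ⟨y, hy, fun z hz => ?_⟩
  rw [← dist_eq_norm, ← dist_eq_norm, ← h]
  exact Metric.infDist_le_dist_of_mem hz

/-- The uniform probability distribution on the unit sphere of `ℝ^d`:
the normalized surface measure. -/
noncomputable def uniformSphere (d : ℕ) :
    Measure (Metric.sphere (0 : EuclideanSpace ℝ (Fin d)) 1) :=
  ((volume : Measure (EuclideanSpace ℝ (Fin d))).toSphere Set.univ)⁻¹ •
    (volume : Measure (EuclideanSpace ℝ (Fin d))).toSphere

/-- The two-point gradient estimator `(d / 2δ) (f (w + δ u) - f (w - δ u)) u`. -/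
noncomputable def gradEstimator {d : ℕ} (δ : ℝ) (f : EuclideanSpace ℝ (Fin d) → ℝ)
    (w : EuclideanSpace ℝ (Fin d)) (u : Metric.sphere (0 : EuclideanSpace ℝ (Fin d)) 1) :
    EuclideanSpace ℝ (Fin d) :=
  ((d : ℝ) / (2 * δ) *
    (f (w + δ • (u : EuclideanSpace ℝ (Fin d))) - f (w - δ • (u : EuclideanSpace ℝ (Fin d))))) •
    (u : EuclideanSpace ℝ (Fin d))

/-- The iterates of projected gradient descent on `(1 - ξ) K` with the two-point estimator, started
at `w 1 = 0`, for the realization `u` of the random directions. Rounds are numbered from `1`;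
the value at `0` is not used. -/
noncomputable def iterate {d : ℕ} (K : Set (EuclideanSpace ℝ (Fin d))) (ξ δ η : ℝ)
    (f : ℕ → EuclideanSpace ℝ (Fin d) → ℝ)
    (u : ℕ → Metric.sphere (0 : EuclideanSpace ℝ (Fin d)) 1) : ℕ → EuclideanSpace ℝ (Fin d)
  | 0 => 0
  | 1 => 0
  | t + 2 =>
    proj ((1 - ξ) • K)
      (iterate K ξ δ η f u (t + 1) -
        η • gradEstimator δ (f (t + 1)) (iterate K ξ δ η f u (t + 1)) (u (t + 1)))

/-- The loss of the player over the rounds `1, …, T`, averaged in each round over the two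
played points `w t + δ u t` and `w t - δ u t`. -/
noncomputable def averagedLoss {d : ℕ} (K : Set (EuclideanSpace ℝ (Fin d))) (ξ δ η : ℝ)
    (f : ℕ → EuclideanSpace ℝ (Fin d) → ℝ) (T : ℕ)
    (u : ℕ → Metric.sphere (0 : EuclideanSpace ℝ (Fin d)) 1) : ℝ :=
  ∑ t ∈ Finset.Icc 1 T, (1 / 2 : ℝ) *
    (f t (iterate K ξ δ η f u t + δ • (u t : EuclideanSpace ℝ (Fin d))) +
      f t (iterate K ξ δ η f u t - δ • (u t : EuclideanSpace ℝ (Fin d))))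

end BanditOGD

/-! For every realization of the directions, descent against the comparators `z t = (1 - ξ) • wstar
t` bounds `∑ ⟪ĝ_t, w_t - z_t⟫` by the square-root term (`sum_inner_le_of_descent`), because `‖ĝ_t‖ ≤
d * G` whatever `δ` is. It remains to see that `ĝ_t` acts in expectation as a subgradient of `f t`
itself, up to `2 * G * δ` (`sub_le_integral_inner_gradEstimator`).

No smoothed loss and no divergence theorem enter. Let `e` be the direction of `w - z` and write `u =
a e + p` with `p ⊥ e`. Reflecting `u` across the line of `e` in one of the two terms of the
estimator puts both evaluation points on the line through `w + δ p` parallel to `e`, where convexity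
in one variable bounds their difference from below. Averaging over `u` and `-u` removes `p` by
convexity, and `E a² = 1/d` cancels the factor `d`.

As `w_t` depends on earlier directions only, `u_t` may be resampled with `w_t` fixed. The errors per
round are multiples of `1/T` and sum to the additive constant. All integrands are continuous on a
compact product of spheres, hence integrable. -/

namespace BanditOGD

open scoped RealInnerProductSpace

/-! ### Symmetry and second moments of the uniform distribution on the sphere. -/

/-- The action of a linear isometry of `ℝ^d` on the unit sphere. -/
noncomputable def sphereHomeomorph {d : ℕ} (R : EuclideanSpace ℝ (Fin d) ≃ₗᵢ[ℝ] EuclideanSpace ℝ (Fin d)) :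
    Metric.sphere (0 : EuclideanSpace ℝ (Fin d)) 1 ≃ₜ
      Metric.sphere (0 : EuclideanSpace ℝ (Fin d)) 1 where
  toFun u := ⟨R u, by simp⟩
  invFun u := ⟨R.symm u, by simp⟩
  left_inv u := by simp
  right_inv u := by simp
  continuous_toFun := by fun_prop
  continuous_invFun := by fun_prop

@[simp] theorem coe_sphereHomeomorph {d : ℕ}
    (R : EuclideanSpace ℝ (Fin d) ≃ₗᵢ[ℝ] EuclideanSpace ℝ (Fin d))
    (u : Metric.sphere (0 : EuclideanSpace ℝ (Fin d)) 1) :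
    (sphereHomeomorph R u : EuclideanSpace ℝ (Fin d)) = R u := rfl

theorem isProbabilityMeasure_uniformSphere {d : ℕ} (hd : 1 ≤ d) :
    IsProbabilityMeasure (uniformSphere d) := by
  have : NeZero d := ⟨by omega⟩
  refine ⟨?_⟩
  rw [uniformSphere, Measure.smul_apply, smul_eq_mul]
  refine ENNReal.inv_mul_cancel ?_ (measure_ne_top _ _)
  rw [Measure.measure_univ_ne_zero, Ne, Measure.toSphere_eq_zero_iff_finrank,
    finrank_euclideanSpace_fin]
  omega

/-- `toSphere` measures a set by the volume of the cone over it, and an isometry maps cones to cones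
preserving volume. -/
theorem measurePreserving_sphereHomeomorph {d : ℕ}
    (R : EuclideanSpace ℝ (Fin d) ≃ₗᵢ[ℝ] EuclideanSpace ℝ (Fin d)) :
    MeasurePreserving (sphereHomeomorph R) (uniformSphere d) (uniformSphere d) := by
  refine MeasurePreserving.smul_measure ?_ _
  refine ⟨(sphereHomeomorph R).continuous.measurable, ?_⟩
  ext s hs
  have hm := (sphereHomeomorph R).continuous.measurable hs
  rw [Measure.map_apply (sphereHomeomorph R).continuous.measurable hs,
    Measure.toSphere_apply' _ hm, Measure.toSphere_apply' _ hs]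
  congr 1
  refine Eq.trans ?_ (R.measurePreserving.measure_preimage_equiv (f := R.toMeasurableEquiv) _)
  congr 1
  ext x
  simp only [Set.mem_smul, Set.mem_preimage, Set.mem_image]
  constructor
  · rintro ⟨a, ha, _, ⟨u, hu, rfl⟩, rfl⟩
    exact ⟨a, ha, _, ⟨_, hu, rfl⟩, (map_smul R a (u : EuclideanSpace ℝ (Fin d))).symm⟩
  · rintro ⟨a, ha, _, ⟨u, hu, rfl⟩, h⟩
    refine ⟨a, ha, _, ⟨(sphereHomeomorph R).symm u, by simpa using hu, rfl⟩, ?_⟩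
    apply R.injective
    rw [map_smul, ← coe_sphereHomeomorph, Homeomorph.apply_symm_apply]
    exact h

theorem integral_sphereHomeomorph {d : ℕ}
    (R : EuclideanSpace ℝ (Fin d) ≃ₗᵢ[ℝ] EuclideanSpace ℝ (Fin d))
    (g : Metric.sphere (0 : EuclideanSpace ℝ (Fin d)) 1 → ℝ) :
    ∫ u, g (sphereHomeomorph R u) ∂uniformSphere d = ∫ u, g u ∂uniformSphere d :=
  (measurePreserving_sphereHomeomorph R).integral_comp
    (sphereHomeomorph R).measurableEmbedding g

theorem integrable_uniformSphere {d : ℕ} (hd : 1 ≤ d)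
    {g : Metric.sphere (0 : EuclideanSpace ℝ (Fin d)) 1 → ℝ} (hg : Continuous g) :
    Integrable g (uniformSphere d) := by
  have := isProbabilityMeasure_uniformSphere hd
  exact hg.integrable_of_hasCompactSupport (HasCompactSupport.of_compactSpace g)

/-- The second moment of the uniform distribution on the sphere in any direction is `1 / d`. -/
theorem integral_inner_sq {d : ℕ} (hd : 1 ≤ d) {e : EuclideanSpace ℝ (Fin d)} (he : ‖e‖ = 1) :
    ∫ u, ⟪e, (u : EuclideanSpace ℝ (Fin d))⟫ ^ 2 ∂uniformSphere d = 1 / d := by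
  have := isProbabilityMeasure_uniformSphere hd
  -- A reflection exchanges `e` with any coordinate vector, so the `d` coordinate moments all equal
  -- the one sought; they sum to `‖u‖² = 1`.
  have key : ∀ i : Fin d, ∫ u, ⟪EuclideanSpace.single i (1 : ℝ),
      (u : EuclideanSpace ℝ (Fin d))⟫ ^ 2 ∂uniformSphere d =
      ∫ u, ⟪e, (u : EuclideanSpace ℝ (Fin d))⟫ ^ 2 ∂uniformSphere d := by
    intro i
    set b := EuclideanSpace.single i (1 : ℝ)
    have hb : ‖e‖ = ‖b‖ := by simp [b, he]
    let R := (ℝ ∙ (e - b))ᗮ.reflection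
    have hR : R e = b := Submodule.reflection_sub hb
    rw [← integral_sphereHomeomorph R]
    refine integral_congr_ae (.of_forall fun u => ?_)
    simp only [coe_sphereHomeomorph]
    rw [← hR, R.inner_map_map]
  have hsum : ∑ i : Fin d, ∫ u, ⟪EuclideanSpace.single i (1 : ℝ),
      (u : EuclideanSpace ℝ (Fin d))⟫ ^ 2 ∂uniformSphere d = 1 := by
    rw [← integral_finsetSum _ fun i _ => integrable_uniformSphere hd (by fun_prop)]
    have : ∀ u : Metric.sphere (0 : EuclideanSpace ℝ (Fin d)) 1,
        ∑ i : Fin d, ⟪EuclideanSpace.single i (1 : ℝ), (u : EuclideanSpace ℝ (Fin d))⟫ ^ 2 = 1 := by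
      intro u
      have h : ‖(u : EuclideanSpace ℝ (Fin d))‖ = 1 := by simp
      have h2 := EuclideanSpace.real_norm_sq_eq (u : EuclideanSpace ℝ (Fin d))
      rw [h] at h2
      simp only [EuclideanSpace.inner_single_left]
      simpa using h2.symm
    simp [this]
  simp only [key, Finset.sum_const, Finset.card_univ, Fintype.card_fin, nsmul_eq_mul] at hsum
  have : (d : ℝ) ≠ 0 := by positivity
  field_simp
  linarith

/-! ### The two-point estimator as an approximate subgradient. -/

/-- The symmetric difference quotient of a convex Lipschitz function at `0` bounds the increment
over `[-l, 0]` from above, up to an error linear in the step `c`. -/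
theorem convexOn_symm_diff_lower {S : Set ℝ} {φ : ℝ → ℝ} (hφ : ConvexOn ℝ S φ) {G : ℝ} (hG : 0 ≤ G)
    (hL : ∀ x ∈ S, ∀ y ∈ S, φ x - φ y ≤ G * |x - y|) {c l : ℝ} (hc : 0 ≤ c) (hl : 0 ≤ l)
    (h1 : c ∈ S) (h2 : -c ∈ S) (h3 : -l ∈ S) :
    2 * c * (φ 0 - φ (-l) - G * c) ≤ (φ c - φ (-c)) * l := by
  rcases hc.eq_or_lt with rfl | hc
  · simp
  rcases le_total c l with hcl | hcl
  -- Here `-c` lies between `-l` and `c`; combined with midpoint convexity at `0` this gives the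
  -- bound even without the error term.
  · have hs : 0 < l + c := by linarith
    have e1 := hφ.2 h3 h1 (show 0 ≤ 2 * c / (l + c) by positivity)
      (show 0 ≤ (l - c) / (l + c) from div_nonneg (by linarith) hs.le) (by field_simp; ring)
    have e2 := hφ.2 h1 h2 (show (0 : ℝ) ≤ 1 / 2 by norm_num) (show (0 : ℝ) ≤ 1 / 2 by norm_num)
      (by norm_num)
    have r1 : (2 * c / (l + c)) • (-l) + ((l - c) / (l + c)) • c = -c := by
      simp only [smul_eq_mul]; field_simp; ring
    have r2 : (1 / 2 : ℝ) • c + (1 / 2 : ℝ) • (-c) = 0 := by simp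
    rw [r1] at e1
    rw [r2] at e2
    simp only [smul_eq_mul] at e1 e2
    have e3 : φ (-c) * (l + c) ≤ 2 * c * φ (-l) + (l - c) * φ c := by
      have := mul_le_mul_of_nonneg_right e1 hs.le
      have r3 : (2 * c / (l + c) * φ (-l) + (l - c) / (l + c) * φ c) * (l + c)
        = 2 * c * φ (-l) + (l - c) * φ c := by field_simp
      linarith
    have e4 := mul_le_mul_of_nonneg_left e2 hc.le
    have : 0 ≤ G * c * c := by positivity
    linarith
  -- Now `-c` lies beyond `-l`, out of reach of convexity: `0` is interpolated between `-l` and `c`,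
  -- and `φ (-c)` is compared with `φ (-l)` by the Lipschitz bound.
  · have hs : 0 < l + c := by linarith
    have e1 := hφ.2 h3 h1 (show 0 ≤ c / (l + c) by positivity)
      (show 0 ≤ l / (l + c) by positivity) (by field_simp; ring)
    have r1 : (c / (l + c)) • (-l) + (l / (l + c)) • c = 0 := by
      simp only [smul_eq_mul]; field_simp; ring
    have h0 : (0 : ℝ) ∈ S := by
      rw [← r1]
      exact hφ.1 h3 h1 (by positivity) (by positivity) (by field_simp; ring)
    rw [r1] at e1
    simp only [smul_eq_mul] at e1
    have e3 : φ 0 * (l + c) ≤ c * φ (-l) + l * φ c := by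
      have := mul_le_mul_of_nonneg_right e1 hs.le
      have r3 : (c / (l + c) * φ (-l) + l / (l + c) * φ c) * (l + c)
        = c * φ (-l) + l * φ c := by field_simp
      linarith
    have l1 := hL _ h2 _ h3
    have l2 := hL _ h0 _ h3
    rw [show -c - -l = -(c - l) by ring, abs_neg, abs_of_nonneg (by linarith)] at l1
    rw [show 0 - -l = l by ring, abs_of_nonneg hl] at l2
    have m1 := mul_le_mul_of_nonneg_left l1 hl
    have m2 := mul_le_mul_of_nonneg_left l2 (sub_nonneg.2 hcl)
    have m3 : 0 ≤ G * (c * (c - l)) :=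
      mul_nonneg hG (mul_nonneg hc.le (sub_nonneg.2 hcl))
    have m4 : 0 ≤ G * (l * l) := by positivity
    nlinarith

/-- The restriction of `f` to a line. The extra factor `c` makes both sides even in `c`, so the sign
of the component `⟪e, u⟫` does not matter later. -/
theorem convexOn_symm_diff_lower_vector {E : Type*} [NormedAddCommGroup E] [NormedSpace ℝ E]
    {K : Set E} {f : E → ℝ} (hf : ConvexOn ℝ K f) {G : ℝ≥0} (hL : LipschitzOnWith G f K)
    {x e : E} (he : ‖e‖ = 1) {c l : ℝ} (hl : 0 ≤ l)
    (h1 : x + c • e ∈ K) (h2 : x - c • e ∈ K) (h3 : x - l • e ∈ K) :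
    2 * c ^ 2 * (f x - f (x - l • e) - G * |c|) ≤ (f (x + c • e) - f (x - c • e)) * (c * l) := by
  let A : ℝ →ᵃ[ℝ] E := AffineMap.lineMap x (x + e)
  have hA : ∀ s, A s = x + s • e := fun s => by simp [A, AffineMap.lineMap_apply, add_comm]
  have hφ := hf.comp_affineMap A
  have hLφ : ∀ s ∈ A ⁻¹' K, ∀ t ∈ A ⁻¹' K, (f ∘ A) s - (f ∘ A) t ≤ G * |s - t| := by
    intro s hs t ht
    refine (le_abs_self _).trans ?_
    have := hL.dist_le_mul _ hs _ ht
    rwa [Real.dist_eq, dist_eq_norm, hA, hA, add_sub_add_left_eq_sub, ← sub_smul, norm_smul, he,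
      mul_one, Real.norm_eq_abs, ← hA, ← hA] at this
  have e1 : ∀ s : ℝ, x - s • e = A (-s) := fun s => by rw [hA, neg_smul, sub_eq_add_neg]
  have e0 : f x = (f ∘ A) 0 := by simp [hA]
  rw [e0]
  rw [← hA] at h1 ⊢
  rw [e1] at h2 h3 ⊢
  rw [e1]
  rcases le_total 0 c with hc | hc
  · have := mul_le_mul_of_nonneg_left
      (convexOn_symm_diff_lower hφ G.coe_nonneg hLφ hc hl h1 h2 h3) hc
    rw [abs_of_nonneg hc]
    simp only [Function.comp] at *
    linear_combination this
  · have := mul_le_mul_of_nonneg_left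
      (convexOn_symm_diff_lower hφ G.coe_nonneg hLφ (neg_nonneg.2 hc) hl h2 (by simpa using h1) h3)
      (neg_nonneg.2 hc)
    rw [abs_of_nonpos hc]
    simp only [Function.comp, neg_neg] at *
    linear_combination this

/-- The two-point estimator is, in expectation, a subgradient up to an error `2 G δ`. -/
theorem sub_le_integral_inner_gradEstimator {d : ℕ} (hd : 1 ≤ d)
    {K : Set (EuclideanSpace ℝ (Fin d))} {f : EuclideanSpace ℝ (Fin d) → ℝ}
    (hf : ConvexOn ℝ K f) {G : ℝ≥0} (hL : LipschitzOnWith G f K) {δ : ℝ} (hδ : 0 < δ)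
    {w z : EuclideanSpace ℝ (Fin d)} (hw : Metric.closedBall w δ ⊆ K)
    (hz : Metric.closedBall z δ ⊆ K) :
    f w - f z - 2 * (G * δ) ≤ ∫ u, ⟪gradEstimator δ f w u, w - z⟫ ∂uniformSphere d := by
  have := isProbabilityMeasure_uniformSphere hd
  rcases eq_or_ne w z with rfl | hne
  · simp only [sub_self, inner_zero_right, integral_zero]
    have : 0 ≤ 2 * (G * δ) := by positivity
    linarith
  set l := ‖w - z‖
  have hl : 0 < l := norm_pos_iff.2 (sub_ne_zero.2 hne)
  set e : EuclideanSpace ℝ (Fin d) := l⁻¹ • (w - z)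
  have he : ‖e‖ = 1 := by
    simp only [e, norm_smul, norm_inv, Real.norm_eq_abs, abs_of_pos hl]
    exact inv_mul_cancel₀ hl.ne'
  have hle : w - z = l • e := by simp only [e, smul_smul, mul_inv_cancel₀ hl.ne', one_smul]
  let a : Metric.sphere (0 : EuclideanSpace ℝ (Fin d)) 1 → ℝ := fun u => ⟪e, u⟫
  let p : Metric.sphere (0 : EuclideanSpace ℝ (Fin d)) 1 → EuclideanSpace ℝ (Fin d) :=
    fun u => u - a u • e
  have ha_cont : Continuous a := by fun_prop
  have hp_cont : Continuous p := by fun_prop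
  have hu : ∀ u : Metric.sphere (0 : EuclideanSpace ℝ (Fin d)) 1,
      ‖(u : EuclideanSpace ℝ (Fin d))‖ = 1 := fun u => by simp
  have ha : ∀ u, |a u| ≤ 1 := fun u => by
    simpa [he, hu] using abs_real_inner_le_norm e (u : EuclideanSpace ℝ (Fin d))
  have hp : ∀ u, ‖p u‖ ≤ 1 := fun u => by
    have h : ‖p u‖ ^ 2 = 1 - a u ^ 2 := by
      simp only [p, norm_sub_sq_real, hu, inner_smul_right, norm_smul, he, a, Real.norm_eq_abs]
      rw [real_inner_comm, mul_one, sq_abs]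
      ring
    nlinarith [sq_nonneg (a u), norm_nonneg (p u)]
  have mem_w : ∀ v : EuclideanSpace ℝ (Fin d), ‖v‖ ≤ 1 → w + δ • v ∈ K := fun v hv =>
    hw (by simpa [norm_smul, abs_of_pos hδ] using mul_le_of_le_one_right hδ.le hv)
  have mem_w' : ∀ v : EuclideanSpace ℝ (Fin d), ‖v‖ ≤ 1 → w - δ • v ∈ K := fun v hv => by
    simpa [sub_eq_add_neg] using mem_w (-v) (by simpa using hv)
  have mem_z : ∀ v : EuclideanSpace ℝ (Fin d), ‖v‖ ≤ 1 → z + δ • v ∈ K := fun v hv =>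
    hz (by simpa [norm_smul, abs_of_pos hδ] using mul_le_of_le_one_right hδ.le hv)
  have cont {g : Metric.sphere (0 : EuclideanSpace ℝ (Fin d)) 1 → EuclideanSpace ℝ (Fin d)}
      (hg : Continuous g) (hgK : ∀ u, g u ∈ K) : Continuous fun u => f (g u) :=
    hL.continuousOn.comp_continuous hg hgK
  -- `R` fixes the component `a` along `e` and negates the orthogonal part `p`.
  let R := (ℝ ∙ e).reflection
  have hR : ∀ u : Metric.sphere (0 : EuclideanSpace ℝ (Fin d)) 1,
      (sphereHomeomorph R u : EuclideanSpace ℝ (Fin d)) = (2 * a u) • e - u := fun u => by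
    rw [coe_sphereHomeomorph]
    simp only [R, Submodule.reflection_singleton_apply, he]
    simp [a, mul_smul, two_smul]
  have haR : ∀ u, a (sphereHomeomorph R u) = a u := fun u => by
    simp only [a]
    rw [hR, inner_sub_right, inner_smul_right, real_inner_self_eq_norm_sq, he]
    simp only [a]
    ring
  let F₁ : Metric.sphere (0 : EuclideanSpace ℝ (Fin d)) 1 → ℝ :=
    fun u => d / (2 * δ) * f (w + δ • (u : EuclideanSpace ℝ (Fin d))) * (a u * l)
  let F₂ : Metric.sphere (0 : EuclideanSpace ℝ (Fin d)) 1 → ℝ :=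
    fun u => d / (2 * δ) * f (w - δ • (u : EuclideanSpace ℝ (Fin d))) * (a u * l)
  let J : Metric.sphere (0 : EuclideanSpace ℝ (Fin d)) 1 → ℝ :=
    fun u => d * a u ^ 2 * (f (w + δ • p u) - f z - 2 * (G * δ))
  have cF₁ : Continuous F₁ :=
    (continuous_const.mul (cont (by fun_prop) fun u => mem_w _ (hu u).le)).mul (by fun_prop)
  have cF₂ : Continuous F₂ :=
    (continuous_const.mul (cont (by fun_prop) fun u => mem_w' _ (hu u).le)).mul (by fun_prop)
  have cJ : Continuous J :=
    Continuous.mul (by fun_prop)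
      (((cont (by fun_prop) fun u => mem_w _ (hp u)).sub continuous_const).sub continuous_const)
  have cF₂R : Continuous fun u => F₂ (sphereHomeomorph R u) :=
    cF₂.comp (sphereHomeomorph R).continuous
  -- Invariance under `R` is applied to the second term alone, which aligns the two evaluation
  -- points along `e`.
  have hsplit : ∫ u, ⟪gradEstimator δ f w u, w - z⟫ ∂uniformSphere d =
      ∫ u, (F₁ u - F₂ (sphereHomeomorph R u)) ∂uniformSphere d := by
    rw [integral_sub (integrable_uniformSphere hd cF₁) (integrable_uniformSphere hd cF₂R),
      integral_sphereHomeomorph, ← integral_sub (integrable_uniformSphere hd cF₁)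
        (integrable_uniformSphere hd cF₂)]
    refine integral_congr_ae (.of_forall fun u => ?_)
    simp only [gradEstimator, F₁, F₂, hle, inner_smul_right, a, real_inner_comm e]
    ring
  -- The evaluation points are `w + δ p ± δ a e`. Of the error `2 * G * δ`, one half is the
  -- one-variable error and the other replaces `z + δ p` by `z`.
  have hJ : ∀ u, J u ≤ F₁ u - F₂ (sphereHomeomorph R u) := fun u => by
    have h1 : w + δ • p u + (δ * a u) • e = w + δ • (u : EuclideanSpace ℝ (Fin d)) := by
      simp only [p]; module
    have h2 : w + δ • p u - (δ * a u) • e =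
        w - δ • (sphereHomeomorph R u : EuclideanSpace ℝ (Fin d)) := by
      rw [hR]; simp only [p]; module
    have h3 : w + δ • p u - l • e = z + δ • p u := by rw [← hle]; abel
    have key := convexOn_symm_diff_lower_vector hf hL he (x := w + δ • p u) (c := δ * a u) hl.le
      (by rw [h1]; exact mem_w _ (hu u).le) (by rw [h2]; exact mem_w' _ (hu _).le)
      (by rw [h3]; exact mem_z _ (hp u))
    rw [h1, h2, h3, abs_mul, abs_of_pos hδ] at key
    have hzp : f (z + δ • p u) - f z ≤ G * δ := by
      refine (le_abs_self _).trans ?_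
      have := hL.dist_le_mul _ (mem_z _ (hp u)) z (hz (Metric.mem_closedBall_self hδ.le))
      rw [Real.dist_eq, dist_eq_norm, add_sub_cancel_left, norm_smul, Real.norm_eq_abs,
        abs_of_pos hδ] at this
      refine this.trans ?_
      gcongr
      exact mul_le_of_le_one_right hδ.le (hp u)
    have hGa : G * (δ * |a u|) ≤ G * δ := by
      gcongr
      exact mul_le_of_le_one_right hδ.le (ha u)
    simp only [J, F₁, F₂, haR]
    calc d * a u ^ 2 * (f (w + δ • p u) - f z - 2 * (G * δ))
        ≤ d * a u ^ 2 * (f (w + δ • p u) - f (z + δ • p u) - G * (δ * |a u|)) := by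
          gcongr ?_ * ?_
          linarith
      _ = d / (2 * δ ^ 2) *
          (2 * (δ * a u) ^ 2 * (f (w + δ • p u) - f (z + δ • p u) - G * (δ * |a u|))) := by
          field_simp
      _ ≤ _ := mul_le_mul_of_nonneg_left key (by positivity)
      _ = _ := by field_simp
  -- The antipodal map changes `p` to `-p` and keeps `a ^ 2`, so `w` becomes the midpoint of the two
  -- base points.
  let N := LinearIsometryEquiv.neg ℝ (E := EuclideanSpace ℝ (Fin d))
  have haN : ∀ u, a (sphereHomeomorph N u) = - a u := fun u => by simp [a, N]
  have hpN : ∀ u, p (sphereHomeomorph N u) = - p u := fun u => by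
    simp only [p, haN]; simp only [coe_sphereHomeomorph, N, LinearIsometryEquiv.coe_neg]; module
  have cJN : Continuous fun u => J (sphereHomeomorph N u) := cJ.comp (sphereHomeomorph N).continuous
  have hsymm : 2 * ∫ u, J u ∂uniformSphere d =
      ∫ u, (J u + J (sphereHomeomorph N u)) ∂uniformSphere d := by
    rw [integral_add (integrable_uniformSphere hd cJ) (integrable_uniformSphere hd cJN),
      integral_sphereHomeomorph, two_mul]
  have hJen : ∀ u, 2 * d * (f w - f z - 2 * (G * δ)) * a u ^ 2 ≤
      J u + J (sphereHomeomorph N u) := fun u => by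
    have hm := hf.2 (mem_w _ (hp u)) (mem_w' _ (hp u)) (show (0 : ℝ) ≤ 1 / 2 by norm_num)
      (show (0 : ℝ) ≤ 1 / 2 by norm_num) (by norm_num)
    have hc : (1 / 2 : ℝ) • (w + δ • p u) + (1 / 2 : ℝ) • (w - δ • p u) = w := by module
    rw [hc] at hm
    simp only [smul_eq_mul] at hm
    simp only [J, haN, hpN, smul_neg, ← sub_eq_add_neg]
    have : 0 ≤ d * a u ^ 2 := by positivity
    linear_combination 2 * mul_le_mul_of_nonneg_left hm this
  have h1 := integral_mono (μ := uniformSphere d)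
    (integrable_uniformSphere hd (by fun_prop))
    (integrable_uniformSphere hd (cJ.add cJN)) hJen
  have h2 := integral_mono (μ := uniformSphere d) (integrable_uniformSphere hd cJ)
    (integrable_uniformSphere hd (cF₁.sub cF₂R)) hJ
  rw [integral_const_mul, integral_inner_sq hd he] at h1
  have hd0 : (d : ℝ) ≠ 0 := by positivity
  have h3 : 2 * d * (f w - f z - 2 * (G * δ)) * (1 / d) = 2 * (f w - f z - 2 * (G * δ)) := by
    field_simp
  rw [h3] at h1
  have h4 := hsymm.ge
  simp only [Pi.add_apply, Pi.sub_apply] at h1 h2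
  rw [hsplit]
  linarith

/-- The two evaluation points are `2 * δ` apart, so the Lipschitz bound cancels the denominator `2 *
δ`. -/
theorem norm_gradEstimator_le {d : ℕ} {K : Set (EuclideanSpace ℝ (Fin d))}
    {f : EuclideanSpace ℝ (Fin d) → ℝ} {G : ℝ≥0} (hL : LipschitzOnWith G f K) {δ : ℝ} (hδ : 0 < δ)
    {w : EuclideanSpace ℝ (Fin d)} (hw : Metric.closedBall w δ ⊆ K)
    (u : Metric.sphere (0 : EuclideanSpace ℝ (Fin d)) 1) :
    ‖gradEstimator δ f w u‖ ≤ d * G := by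
  have hu : ‖(u : EuclideanSpace ℝ (Fin d))‖ = 1 := by simp
  have h := hL.dist_le_mul (w + δ • (u : EuclideanSpace ℝ (Fin d)))
    (hw (by simp [norm_smul, abs_of_pos hδ]))
    (w - δ • (u : EuclideanSpace ℝ (Fin d))) (hw (by simp [norm_smul, abs_of_pos hδ]))
  have h' : w + δ • (u : EuclideanSpace ℝ (Fin d)) - (w - δ • (u : EuclideanSpace ℝ (Fin d))) =
    (2 * δ) • (u : EuclideanSpace ℝ (Fin d)) := by module
  rw [Real.dist_eq, dist_eq_norm, h', norm_smul, hu, Real.norm_eq_abs,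
    abs_of_pos (show 0 < 2 * δ by positivity)] at h
  rw [gradEstimator, norm_smul, hu, mul_one, Real.norm_eq_abs, abs_mul,
    abs_of_nonneg (show 0 ≤ d / (2 * δ) by positivity)]
  calc d / (2 * δ) * |_| ≤ d / (2 * δ) * (G * (2 * δ * 1)) := by gcongr
    _ = d * G := by field_simp

/-! ### Euclidean projection and the shrunken set. -/

theorem inner_sub_proj_le_zero {d : ℕ} {C : Set (EuclideanSpace ℝ (Fin d))} (hconv : Convex ℝ C)
    (hclosed : IsClosed C) (hne : C.Nonempty) (x : EuclideanSpace ℝ (Fin d))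
    {z : EuclideanSpace ℝ (Fin d)} (hz : z ∈ C) : ⟪x - proj C x, z - proj C x⟫ ≤ 0 := by
  obtain ⟨hmem, hmin⟩ := isNearest_proj hclosed hne x
  have : Nonempty C := ⟨⟨_, hmem⟩⟩
  refine (norm_eq_iInf_iff_real_inner_le_zero hconv hmem).1 (le_antisymm ?_ ?_) z hz
  · exact le_ciInf fun y => hmin y y.2
  · exact ciInf_le (f := fun y : C => ‖x - y‖)
      ⟨0, by rintro _ ⟨y, rfl⟩; exact norm_nonneg _⟩ ⟨_, hmem⟩

theorem norm_proj_sub_le {d : ℕ} {C : Set (EuclideanSpace ℝ (Fin d))} (hconv : Convex ℝ C)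
    (hclosed : IsClosed C) (hne : C.Nonempty) (x : EuclideanSpace ℝ (Fin d))
    {z : EuclideanSpace ℝ (Fin d)} (hz : z ∈ C) : ‖proj C x - z‖ ≤ ‖x - z‖ := by
  have h := inner_sub_proj_le_zero hconv hclosed hne x hz
  have e : ‖x - z‖ ^ 2 = ‖x - proj C x‖ ^ 2 - 2 * ⟪x - proj C x, z - proj C x⟫
      + ‖proj C x - z‖ ^ 2 := by
    rw [norm_sub_rev (proj C x) z, ← norm_sub_sq_real]
    congr 2
    abel
  exact (sq_le_sq₀ (norm_nonneg _) (norm_nonneg _)).1 (by nlinarith [sq_nonneg ‖x - proj C x‖])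

theorem continuous_proj {d : ℕ} {C : Set (EuclideanSpace ℝ (Fin d))} (hconv : Convex ℝ C)
    (hclosed : IsClosed C) (hne : C.Nonempty) : Continuous (proj C) := by
  refine LipschitzWith.continuous (K := 1) (LipschitzWith.of_dist_le_mul fun x y => ?_)
  rw [dist_eq_norm, dist_eq_norm, NNReal.coe_one, one_mul]
  have h1 := inner_sub_proj_le_zero hconv hclosed hne x (isNearest_proj hclosed hne y).1
  have h2 := inner_sub_proj_le_zero hconv hclosed hne y (isNearest_proj hclosed hne x).1
  set p := proj C x
  set q := proj C y
  -- The last two inner products are nonpositive by the obtuse-angle property, leaving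
  -- Cauchy–Schwarz for the first.
  have h3 : ‖p - q‖ ^ 2 = ⟪x - y, p - q⟫ + ⟪x - p, q - p⟫ + ⟪y - q, p - q⟫ := by
    rw [← real_inner_self_eq_norm_sq, ← neg_sub p q, inner_neg_right]
    simp only [inner_sub_left]
    ring
  have h4 := real_inner_le_norm (x - y) (p - q)
  rcases (norm_nonneg (p - q)).eq_or_lt with h | h
  · rw [← h]; positivity
  · refine le_of_mul_le_mul_right ?_ h
    linarith

/-- Points of the shrunken set `(1 - ξ) K` keep a ball of radius `ξ R₁` inside `K`. -/
theorem closedBall_subset_of_mem_smul {E : Type*} [NormedAddCommGroup E] [NormedSpace ℝ E]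
    {K : Set E} (hK : Convex ℝ K) {R₁ ξ : ℝ} (hR₁K : Metric.closedBall 0 R₁ ⊆ K) (hξ : 0 < ξ)
    (hξ1 : ξ ≤ 1) {w : E} (hw : w ∈ (1 - ξ) • K) : Metric.closedBall w (ξ * R₁) ⊆ K := by
  rintro x hx
  obtain ⟨k, hk, rfl⟩ := hw
  rw [mem_closedBall_iff_norm] at hx
  have hy : ξ⁻¹ • (x - (1 - ξ) • k) ∈ K := by
    apply hR₁K
    rw [mem_closedBall_zero_iff, norm_smul, norm_inv, Real.norm_eq_abs, abs_of_pos hξ]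
    exact (inv_mul_le_iff₀ hξ).2 hx
  have := hK hk hy (sub_nonneg.2 hξ1) hξ.le (by ring)
  rwa [smul_smul, mul_inv_cancel₀ hξ.ne', one_smul, add_sub_cancel] at this

/-! ### Causality, feasibility and continuity of the iterates. -/

section Iterate

variable {d : ℕ} {K : Set (EuclideanSpace ℝ (Fin d))} {ξ δ η : ℝ}
  {f : ℕ → EuclideanSpace ℝ (Fin d) → ℝ}

theorem iterate_succ {t : ℕ} (ht : 1 ≤ t)
    (u : ℕ → Metric.sphere (0 : EuclideanSpace ℝ (Fin d)) 1) :
    iterate K ξ δ η f u (t + 1) = proj ((1 - ξ) • K)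
      (iterate K ξ δ η f u t - η • gradEstimator δ (f t) (iterate K ξ δ η f u t) (u t)) := by
  obtain ⟨s, rfl⟩ := Nat.exists_eq_add_of_le' ht
  rw [iterate]

/-- The strict bound `s < n` expresses causality: the iterate of round `n` does not see the
direction of round `n`. -/
theorem iterate_congr {u v : ℕ → Metric.sphere (0 : EuclideanSpace ℝ (Fin d)) 1} :
    ∀ {n : ℕ}, (∀ s, 1 ≤ s → s < n → u s = v s) →
      iterate K ξ δ η f u n = iterate K ξ δ η f v n
  | 0, _ => by simp only [iterate]
  | 1, _ => by simp only [iterate]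
  | n + 2, h => by
    rw [iterate, iterate, iterate_congr fun s h1 h2 => h s h1 (by omega),
      h (n + 1) (by omega) (by omega)]

theorem iterate_mem (h0 : 0 ∈ K) (hC : IsClosed ((1 - ξ) • K))
    (u : ℕ → Metric.sphere (0 : EuclideanSpace ℝ (Fin d)) 1) :
    ∀ n, iterate K ξ δ η f u n ∈ (1 - ξ) • K
  | 0 => ⟨0, h0, by simp [iterate]⟩
  | 1 => ⟨0, h0, by simp [iterate]⟩
  | n + 2 => by
    rw [iterate]
    exact (isNearest_proj hC ⟨_, 0, h0, rfl⟩ _).1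

theorem continuous_gradEstimator {X : Type*} [TopologicalSpace X] {G : ℝ≥0}
    {g : EuclideanSpace ℝ (Fin d) → ℝ} (hL : LipschitzOnWith G g K) (hδ : 0 < δ)
    {W : X → EuclideanSpace ℝ (Fin d)} (hW : Continuous W)
    (hWK : ∀ x, Metric.closedBall (W x) δ ⊆ K)
    {v : X → Metric.sphere (0 : EuclideanSpace ℝ (Fin d)) 1} (hv : Continuous v) :
    Continuous fun x => gradEstimator δ g (W x) (v x) := by
  have h1 : Continuous fun x => g (W x + δ • (v x : EuclideanSpace ℝ (Fin d))) :=
    hL.continuousOn.comp_continuous (by fun_prop)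
      fun x => hWK x (by simp [norm_smul, abs_of_pos hδ])
  have h2 : Continuous fun x => g (W x - δ • (v x : EuclideanSpace ℝ (Fin d))) :=
    hL.continuousOn.comp_continuous (by fun_prop)
      fun x => hWK x (by simp [norm_smul, abs_of_pos hδ])
  exact (continuous_const.mul (h1.sub h2)).smul (continuous_subtype_val.comp hv)

/-- This supplies all measurability and integrability. The losses are continuous only on `K`, so the
evaluation points must be kept there by `hball`. -/
theorem continuous_iterate (hδ : 0 < δ) (h0 : 0 ∈ K) (hK : Convex ℝ K)
    (hC : IsClosed ((1 - ξ) • K)) (hball : ∀ w ∈ (1 - ξ) • K, Metric.closedBall w δ ⊆ K) {T : ℕ}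
    {G : ℝ≥0} (hL : ∀ t ∈ Finset.Icc 1 T, LipschitzOnWith G (f t) K) :
    ∀ n ≤ T + 1, Continuous fun u => iterate K ξ δ η f u n
  | 0, _ => by simp only [iterate]; fun_prop
  | 1, _ => by simp only [iterate]; fun_prop
  | n + 2, hn => by
    simp only [iterate]
    have ih := continuous_iterate hδ h0 hK hC hball hL (n + 1) (by omega)
    have hg := continuous_gradEstimator (hL (n + 1) (Finset.mem_Icc.2 ⟨by omega, by omega⟩)) hδ ih
      (fun u => hball _ (iterate_mem h0 hC u _)) (continuous_apply (n + 1))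
    exact (continuous_proj (hK.smul _) hC ⟨_, 0, h0, rfl⟩).comp (ih.sub (hg.const_smul η))

end Iterate

/-! ### Descent against a moving comparator. -/

/-- The basic inequality of online gradient descent against a moving comparator. -/
theorem sum_inner_le_of_descent {E : Type*} [NormedAddCommGroup E] [InnerProductSpace ℝ E]
    {w g z : ℕ → E} {r D η : ℝ} :
    ∀ {T : ℕ}, 1 ≤ T →
    (∀ t ∈ Finset.Icc 1 T, ‖w (t + 1) - z t‖ ≤ ‖w t - η • g t - z t‖) →
    (∀ t ∈ Finset.Icc 1 T, ‖g t‖ ≤ D) →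
    (∀ t ∈ Finset.Icc 1 T, ‖w t - z t‖ ≤ r) →
    (∀ t ∈ Finset.Icc 1 T, ‖w (t + 1) - z t‖ ≤ r) →
    2 * η * ∑ t ∈ Finset.Icc 1 T, ⟪g t, w t - z t⟫ ≤
      r ^ 2 + 2 * r * ∑ t ∈ Finset.Ico 1 T, ‖z t - z (t + 1)‖ + T * (η ^ 2 * D ^ 2)
        - ‖w (T + 1) - z T‖ ^ 2 := by
  have step : ∀ t, ‖w (t + 1) - z t‖ ≤ ‖w t - η • g t - z t‖ → ‖g t‖ ≤ D →
      2 * η * ⟪g t, w t - z t⟫ ≤ ‖w t - z t‖ ^ 2 - ‖w (t + 1) - z t‖ ^ 2 + η ^ 2 * D ^ 2 := by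
    intro t h1 h2
    have h3 : ‖w (t + 1) - z t‖ ^ 2 ≤ ‖w t - η • g t - z t‖ ^ 2 := by gcongr
    rw [show w t - η • g t - z t = w t - z t - η • g t by abel,
      norm_sub_sq_real (w t - z t), inner_smul_right, norm_smul, mul_pow, Real.norm_eq_abs, sq_abs, real_inner_comm] at h3
    have h4 : η ^ 2 * ‖g t‖ ^ 2 ≤ η ^ 2 * D ^ 2 := by gcongr
    linarith
  intro T hT
  -- The subtracted square in the conclusion is what the next round's distance is compared with.
  induction T, hT using Nat.le_induction with
  | base =>
    intro h1 h2 h3 _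
    have h := step 1 (h1 1 (by simp)) (h2 1 (by simp))
    have h5 : ‖w 1 - z 1‖ ^ 2 ≤ r ^ 2 := by gcongr; exact h3 1 (by simp)
    simp
    linarith
  | succ n hn ih =>
    intro h1 h2 h3 h4
    have hsub : ∀ t ∈ Finset.Icc 1 n, t ∈ Finset.Icc 1 (n + 1) := fun t ht => by
      simp only [Finset.mem_Icc] at ht ⊢; omega
    have hmem : n + 1 ∈ Finset.Icc 1 (n + 1) := by simp
    have hi := ih (fun t ht => h1 t (hsub t ht)) (fun t ht => h2 t (hsub t ht))
      (fun t ht => h3 t (hsub t ht)) (fun t ht => h4 t (hsub t ht))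
    have h := step (n + 1) (h1 _ hmem) (h2 _ hmem)
    have ha := h3 _ hmem
    have hb := h4 n (Finset.mem_Icc.2 ⟨hn, by omega⟩)
    have hc : ‖w (n + 1) - z (n + 1)‖ - ‖w (n + 1) - z n‖ ≤ ‖z n - z (n + 1)‖ := by
      refine (norm_sub_norm_le _ _).trans_eq ?_
      congr 1
      abel
    -- Moving the comparator costs a difference of squares: the sum of the two distances is at most
    -- `2 * r`, their difference at most the comparator's step.
    have hd : ‖w (n + 1) - z (n + 1)‖ ^ 2 - ‖w (n + 1) - z n‖ ^ 2 ≤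
        2 * r * ‖z n - z (n + 1)‖ := by
      rw [sq_sub_sq]
      calc _ ≤ (‖w (n + 1) - z (n + 1)‖ + ‖w (n + 1) - z n‖) * ‖z n - z (n + 1)‖ := by gcongr
        _ ≤ _ := by gcongr; linarith
    rw [Finset.sum_Icc_succ_top (by omega), Finset.sum_Ico_succ_top hn]
    push_cast
    linarith

/-! ### Resampling a direction. -/

/-- Resampling one coordinate preserves a product of copies of a probability measure. -/
theorem measurePreserving_update {ι X : Type*} [Fintype ι] [DecidableEq ι] [MeasurableSpace X]
    (μ : Measure X) [IsProbabilityMeasure μ] (i : ι) :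
    MeasurePreserving (fun q : (ι → X) × X => Function.update q.1 i q.2)
      ((Measure.pi fun _ => μ).prod μ) (Measure.pi fun _ => μ) := by
  have hm : Measurable fun q : (ι → X) × X => Function.update q.1 i q.2 := by fun_prop
  refine ⟨hm, (Measure.pi_eq fun s hs => ?_).symm⟩
  rw [Measure.map_apply hm (MeasurableSet.univ_pi hs)]
  have : (fun q : (ι → X) × X => Function.update q.1 i q.2) ⁻¹' Set.pi Set.univ s =
      Set.pi Set.univ (Function.update s i Set.univ) ×ˢ s i := by
    ext ⟨x, y⟩
    simp only [Set.mem_preimage, Set.mem_pi, Set.mem_univ, true_imp_iff, Set.mem_prod]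
    constructor
    · intro h
      refine ⟨fun j => ?_, by simpa using h i⟩
      rcases eq_or_ne j i with rfl | hj
      · simp
      · simpa [hj] using h j
    · rintro ⟨h, hy⟩ j
      rcases eq_or_ne j i with rfl | hj
      · simpa using hy
      · simpa [hj] using h j
  rw [this, Measure.prod_prod, Measure.pi_pi, ← Finset.mul_prod_erase _ _ (Finset.mem_univ i),
    ← Finset.mul_prod_erase _ (fun j => μ (s j)) (Finset.mem_univ i)]
  simp only [Function.update_self, measure_univ, one_mul]
  rw [mul_comm]
  congr 1
  refine Finset.prod_congr rfl fun j hj => ?_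
  rw [Function.update_of_ne (Finset.ne_of_mem_erase hj)]

theorem integrable_of_continuous_of_compact {X : Type*} [TopologicalSpace X] [CompactSpace X]
    [MeasurableSpace X] [OpensMeasurableSpace X] (μ : Measure X) [IsFiniteMeasure μ]
    {g : X → ℝ} (hg : Continuous g) : Integrable g μ :=
  hg.integrable_of_hasCompactSupport (HasCompactSupport.of_compactSpace g)

/-- The subgradient inequality in expectation at a random point that does not depend on the
direction used by the estimator. -/
theorem integral_sub_le_integral_inner_gradEstimator {d : ℕ} (hd : 1 ≤ d) {ι : Type*} [Fintype ι]
    [DecidableEq ι] {K : Set (EuclideanSpace ℝ (Fin d))} {f : EuclideanSpace ℝ (Fin d) → ℝ}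
    (hf : ConvexOn ℝ K f) {G : ℝ≥0} (hL : LipschitzOnWith G f K) {δ : ℝ} (hδ : 0 < δ)
    {W : (ι → Metric.sphere (0 : EuclideanSpace ℝ (Fin d)) 1) → EuclideanSpace ℝ (Fin d)}
    (hW : Continuous W) (i : ι) (hWi : ∀ x y, W (Function.update x i y) = W x)
    (hWK : ∀ x, Metric.closedBall (W x) δ ⊆ K) {z : EuclideanSpace ℝ (Fin d)}
    (hz : Metric.closedBall z δ ⊆ K) :
    ∫ x, (f (W x) - f z - 2 * (G * δ)) ∂(Measure.pi fun _ => uniformSphere d) ≤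
      ∫ x, ⟪gradEstimator δ f (W x) (x i), W x - z⟫ ∂(Measure.pi fun _ => uniformSphere d) := by
  have := isProbabilityMeasure_uniformSphere hd
  have hprob : IsProbabilityMeasure (Measure.pi fun _ : ι => uniformSphere d) := inferInstance
  have : SFinite (Measure.pi fun _ : ι => uniformSphere d) :=
    @instSFiniteOfSigmaFinite _ _ _ (@IsFiniteMeasure.toSigmaFinite _ _ _ inferInstance)
  have hmp := measurePreserving_update (ι := ι) (uniformSphere d) i
  have hcont : Continuous fun x => ⟪gradEstimator δ f (W x) (x i), W x - z⟫ :=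
    (continuous_gradEstimator hL hδ hW hWK (continuous_apply i)).inner (by fun_prop)
  have hcont' : Continuous fun q : (ι → Metric.sphere (0 : EuclideanSpace ℝ (Fin d)) 1) ×
      Metric.sphere (0 : EuclideanSpace ℝ (Fin d)) 1 =>
      ⟪gradEstimator δ f (W q.1) q.2, W q.1 - z⟫ :=
    (continuous_gradEstimator hL hδ (hW.comp continuous_fst) (fun q => hWK q.1)
      continuous_snd).inner (by fun_prop)
  have hint := integrable_of_continuous_of_compact
    ((Measure.pi fun _ : ι => uniformSphere d).prod (uniformSphere d)) hcont'
  have hfW : Continuous fun x => f (W x) :=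
    hL.continuousOn.comp_continuous hW fun x => hWK x (Metric.mem_closedBall_self hδ.le)
  -- Coordinate `i` is replaced by a fresh direction, which leaves `W` unchanged; Fubini then
  -- reduces the claim to a fixed point `W x`.
  rw [← hmp.map_eq, integral_map hmp.measurable.aemeasurable hcont.aestronglyMeasurable,
    hmp.map_eq]
  simp only [hWi, Function.update_self]
  rw [integral_prod _ hint]
  refine integral_mono (integrable_of_continuous_of_compact _
    ((hfW.sub continuous_const).sub continuous_const)) hint.integral_prod_left fun x => ?_
  exact sub_le_integral_inner_gradEstimator hd hf hL hδ (hWK x) hz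

/-! ### Path variation, step size and finite direction sequences. -/

/-- A real `sSup` dominates its set only if the set is bounded above; `r` bounds each summand. -/
theorem sum_norm_sub_le_pathVariation {d T : ℕ} {K : Set (EuclideanSpace ℝ (Fin d))}
    {f : ℕ → EuclideanSpace ℝ (Fin d) → ℝ} {r : ℝ}
    (hrK : ∀ t ∈ Finset.Icc 1 T, ∀ v ∈ minimizers K (f t), ∀ w ∈ K, ‖w - v‖ ≤ r)
    {v : ℕ → EuclideanSpace ℝ (Fin d)} (hv : ∀ t ∈ Finset.Icc 1 T, v t ∈ minimizers K (f t)) :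
    ∑ t ∈ Finset.Ico 1 T, ‖v t - v (t + 1)‖ ≤ pathVariation K f T := by
  refine le_csSup ⟨(Finset.Ico 1 T).card • r, ?_⟩ ⟨v, hv, rfl⟩
  rintro _ ⟨w, hw, rfl⟩
  refine Finset.sum_le_card_nsmul _ _ _ fun t ht => ?_
  rw [Finset.mem_Ico] at ht
  exact hrK (t + 1) (Finset.mem_Icc.2 ⟨by omega, by omega⟩) _
    (hw _ (Finset.mem_Icc.2 ⟨by omega, by omega⟩)) _
    (hw t (Finset.mem_Icc.2 ⟨by omega, by omega⟩)).1

/-- The step size `√(A / D)` balances the two terms of the regret bound. -/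
theorem le_sqrt_mul_of_two_mul_le {A D η x : ℝ} (hA : 0 < A) (hD : 0 < D) (hη : η = √(A / D))
    (h : 2 * η * x ≤ A + η ^ 2 * D) : x ≤ √(A * D) := by
  have hη0 : 0 < η := hη ▸ Real.sqrt_pos.2 (div_pos hA hD)
  have h2 : η ^ 2 = A / D := by rw [hη, Real.sq_sqrt (div_pos hA hD).le]
  have h3 : √(A * D) = η * D := by
    rw [Real.sqrt_eq_iff_mul_self_eq (by positivity) (by positivity)]
    linear_combination -D ^ 2 * h2 - D * (div_mul_cancel₀ A hD.ne')
  rw [h3]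
  have h4 : η ^ 2 * D = A := by rw [h2]; exact div_mul_cancel₀ A hD.ne'
  refine le_of_mul_le_mul_left (a := 2 * η) ?_ (by positivity)
  linarith

/-- A finite sequence of directions for the rounds `1, …, T`, continued by a fixed direction. -/
noncomputable def extendDirections {d T : ℕ} (s₀ : Metric.sphere (0 : EuclideanSpace ℝ (Fin d)) 1)
    (x : Finset.Icc 1 T → Metric.sphere (0 : EuclideanSpace ℝ (Fin d)) 1) :
    ℕ → Metric.sphere (0 : EuclideanSpace ℝ (Fin d)) 1 :=
  fun n => if h : n ∈ Finset.Icc 1 T then x ⟨n, h⟩ else s₀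

theorem extendDirections_of_mem {d T : ℕ} {s₀ : Metric.sphere (0 : EuclideanSpace ℝ (Fin d)) 1}
    {x : Finset.Icc 1 T → Metric.sphere (0 : EuclideanSpace ℝ (Fin d)) 1} {n : ℕ}
    (h : n ∈ Finset.Icc 1 T) : extendDirections s₀ x n = x ⟨n, h⟩ := dif_pos h

theorem continuous_extendDirections {d T : ℕ}
    (s₀ : Metric.sphere (0 : EuclideanSpace ℝ (Fin d)) 1) :
    Continuous (extendDirections (T := T) s₀) := by
  refine continuous_pi fun n => ?_
  unfold extendDirections
  split_ifs <;> fun_prop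

theorem averagedLoss_congr {d T : ℕ} {K : Set (EuclideanSpace ℝ (Fin d))} {ξ δ η : ℝ}
    {f : ℕ → EuclideanSpace ℝ (Fin d) → ℝ}
    {u v : ℕ → Metric.sphere (0 : EuclideanSpace ℝ (Fin d)) 1}
    (h : ∀ t ∈ Finset.Icc 1 T, u t = v t) :
    averagedLoss K ξ δ η f T u = averagedLoss K ξ δ η f T v := by
  refine Finset.sum_congr rfl fun t ht => ?_
  rw [h t ht, iterate_congr fun s h1 h2 => h s ?_]
  rw [Finset.mem_Icc] at ht ⊢
  omega

end BanditOGD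

/-! ### The regret bound. -/

open BanditOGD
open scoped RealInnerProductSpace

theorem mainTheorem6 {d T : ℕ} (hd : 1 ≤ d) (hT : 1 ≤ T)
    (K : Set (EuclideanSpace ℝ (Fin d))) (hKconv : Convex ℝ K) (hKclosed : IsClosed K)
    (R₁ R₂ : ℝ) (hR₁ : 0 < R₁)
    (hR₁K : Metric.closedBall 0 R₁ ⊆ K) (hKR₂ : K ⊆ Metric.closedBall 0 R₂)
    (f : ℕ → EuclideanSpace ℝ (Fin d) → ℝ) (G : ℝ≥0) (hG : 0 < G)
    (hconv : ∀ t ∈ Finset.Icc 1 T, ConvexOn ℝ K (f t))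
    (hLip : ∀ t ∈ Finset.Icc 1 T, LipschitzOnWith G (f t) K)
    (r : ℝ) (hr : 0 < r)
    (hrK : ∀ t ∈ Finset.Icc 1 T, ∀ v ∈ BanditOGD.minimizers K (f t), ∀ w ∈ K, ‖w - v‖ ≤ r)
    (B : ℝ) (hB : BanditOGD.pathVariation K f T ≤ B)
    {S : Type*} [MeasurableSpace S] (P : Measure S) [IsProbabilityMeasure P]
    (u : ℕ → S → Metric.sphere (0 : EuclideanSpace ℝ (Fin d)) 1)
    (hlaw : ∀ t ∈ Finset.Icc 1 T, HasLaw (u t) (BanditOGD.uniformSphere d) P)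
    (hindep : iIndepFun (fun t : Finset.Icc 1 T => u t) P)
    (ξ δ η : ℝ) (hξ : ξ = 1 / T) (hδ : δ = ξ * R₁)
    (hη : η = √((r ^ 2 + 2 * r * B) / (T * (G : ℝ) ^ 2 * (d : ℝ) ^ 2)))
    (wstar : ℕ → EuclideanSpace ℝ (Fin d))
    (hwstar : ∀ t ∈ Finset.Icc 1 T, wstar t ∈ BanditOGD.minimizers K (f t)) :
    Integrable (fun s => BanditOGD.averagedLoss K ξ δ η f T (fun t => u t s)) P ∧
    (∫ s, BanditOGD.averagedLoss K ξ δ η f T (fun t => u t s) ∂P)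
        - ∑ t ∈ Finset.Icc 1 T, f t (wstar t)
      ≤ √((r ^ 2 + 2 * r * B) * (G : ℝ) ^ 2 * (d : ℝ) ^ 2 * T) + G * (3 * R₁ + R₂) := by
  have := isProbabilityMeasure_uniformSphere hd
  have hT0 : (0 : ℝ) < T := by exact_mod_cast hT
  have hd0 : (0 : ℝ) < d := by exact_mod_cast hd
  have hG0 : (0 : ℝ) < G := by exact_mod_cast hG
  have hξ0 : 0 < ξ := by rw [hξ]; positivity
  -- Equality occurs for `T = 1`, when the shrunken set is `{0}`.
  have hξ1 : ξ ≤ 1 := by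
    rw [hξ, div_le_one hT0]
    exact_mod_cast hT
  have hδ0 : 0 < δ := by rw [hδ]; positivity
  have h0 : (0 : EuclideanSpace ℝ (Fin d)) ∈ K := hR₁K (Metric.mem_closedBall_self hR₁.le)
  have hKcomp : IsCompact K :=
    (isCompact_closedBall (0 : EuclideanSpace ℝ (Fin d)) R₂).of_isClosed_subset hKclosed hKR₂
  have hC : IsClosed ((1 - ξ) • K) := (hKcomp.smul (1 - ξ)).isClosed
  have hball : ∀ w ∈ (1 - ξ) • K, Metric.closedBall w δ ⊆ K := fun w hw => by
    rw [hδ]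
    exact closedBall_subset_of_mem_smul hKconv hR₁K hξ0 hξ1 hw
  have hself : ∀ w ∈ (1 - ξ) • K, w ∈ K := fun w hw =>
    hball w hw (Metric.mem_closedBall_self hδ0.le)
  -- `s₀` fills the rounds outside `1, …, T`, whose directions have no prescribed law.
  obtain ⟨s₀⟩ : Nonempty (Metric.sphere (0 : EuclideanSpace ℝ (Fin d)) 1) :=
    (uniformSphere d).nonempty_of_neZero
  -- The minimizers may lie outside the shrunken set; scaling brings them in and lengthens neither
  -- their path nor their distances to the iterates.
  let z : ℕ → EuclideanSpace ℝ (Fin d) := fun t => (1 - ξ) • wstar t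
  have hz : ∀ t ∈ Finset.Icc 1 T, z t ∈ (1 - ξ) • K := fun t ht =>
    Set.smul_mem_smul_set (hwstar t ht).1
  have hnear : ∀ t ∈ Finset.Icc 1 T, ∀ w ∈ (1 - ξ) • K, ‖w - z t‖ ≤ r := by
    rintro t ht _ ⟨k, hk, rfl⟩
    simp only [z, ← smul_sub, norm_smul, Real.norm_eq_abs, abs_of_nonneg (sub_nonneg.2 hξ1)]
    exact (mul_le_of_le_one_left (norm_nonneg _) (by linarith)).trans
      (hrK t ht _ (hwstar t ht) k hk)
  have hpath : ∑ t ∈ Finset.Ico 1 T, ‖z t - z (t + 1)‖ ≤ B := by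
    refine (Finset.sum_le_sum fun t _ => ?_).trans
      ((sum_norm_sub_le_pathVariation hrK hwstar).trans hB)
    simp only [z, ← smul_sub, norm_smul, Real.norm_eq_abs, abs_of_nonneg (sub_nonneg.2 hξ1)]
    exact mul_le_of_le_one_left (norm_nonneg _) (by linarith)
  have hB0 : 0 ≤ B := (Finset.sum_nonneg fun _ _ => norm_nonneg _).trans hpath
  let W : ℕ → (Finset.Icc 1 T → Metric.sphere (0 : EuclideanSpace ℝ (Fin d)) 1) →
      EuclideanSpace ℝ (Fin d) := fun t x => iterate K ξ δ η f (extendDirections s₀ x) t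
  have hWmem : ∀ t x, W t x ∈ (1 - ξ) • K := fun t x => iterate_mem h0 hC _ _
  have hWcont : ∀ t ∈ Finset.Icc 1 T, Continuous (W t) := fun t ht =>
    (continuous_iterate hδ0 h0 hKconv hC hball hLip t
      ((Finset.mem_Icc.1 ht).2.trans T.le_succ)).comp (continuous_extendDirections s₀)
  have hWupd : ∀ t (ht : t ∈ Finset.Icc 1 T) x y, W t (Function.update x ⟨t, ht⟩ y) = W t x := by
    intro t ht x y
    refine iterate_congr fun s h1 h2 => ?_
    have hs : s ∈ Finset.Icc 1 T := by rw [Finset.mem_Icc] at ht ⊢; omega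
    rw [extendDirections_of_mem hs, extendDirections_of_mem hs, Function.update_of_ne]
    simpa using h2.ne
  set Q : Measure (Finset.Icc 1 T → Metric.sphere (0 : EuclideanSpace ℝ (Fin d)) 1) :=
    Measure.pi fun _ => uniformSphere d
  have hQ : HasLaw (fun s (t : Finset.Icc 1 T) => u t s) Q P :=
    hindep.hasLaw_pi fun t => hlaw t t.2
  let L : (Finset.Icc 1 T → Metric.sphere (0 : EuclideanSpace ℝ (Fin d)) 1) → ℝ :=
    fun x => averagedLoss K ξ δ η f T (extendDirections s₀ x)
  have hL : ∀ s, averagedLoss K ξ δ η f T (fun t => u t s) = L fun t => u t s := fun s =>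
    averagedLoss_congr fun t ht => by rw [extendDirections_of_mem ht]
  let g : Finset.Icc 1 T → (Finset.Icc 1 T → Metric.sphere (0 : EuclideanSpace ℝ (Fin d)) 1) →
      ℝ := fun t x => ⟪gradEstimator δ (f t) (W t x) (x t), W t x - z t⟫
  have hfcont : ∀ t ∈ Finset.Icc 1 T, ∀ {V : (Finset.Icc 1 T → Metric.sphere
      (0 : EuclideanSpace ℝ (Fin d)) 1) → EuclideanSpace ℝ (Fin d)}, Continuous V →
      (∀ x, V x ∈ K) → Continuous fun x => f t (V x) := fun t ht V hV hVK =>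
    (hLip t ht).continuousOn.comp_continuous hV hVK
  have hplus : ∀ t x (v : Metric.sphere (0 : EuclideanSpace ℝ (Fin d)) 1),
      W t x + δ • (v : EuclideanSpace ℝ (Fin d)) ∈ K := fun t x v =>
    hball _ (hWmem t x) (by simp [norm_smul, abs_of_pos hδ0])
  have hminus : ∀ t x (v : Metric.sphere (0 : EuclideanSpace ℝ (Fin d)) 1),
      W t x - δ • (v : EuclideanSpace ℝ (Fin d)) ∈ K := fun t x v =>
    hball _ (hWmem t x) (by simp [norm_smul, abs_of_pos hδ0])
  have hLcont : Continuous L := by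
    refine continuous_finsetSum _ fun t ht => continuous_const.mul (Continuous.add ?_ ?_)
    · exact hfcont t ht ((hWcont t ht).add (((continuous_subtype_val.comp
        ((continuous_apply t).comp (continuous_extendDirections s₀))).const_smul δ)))
        fun x => hplus t x _
    · exact hfcont t ht ((hWcont t ht).sub (((continuous_subtype_val.comp
        ((continuous_apply t).comp (continuous_extendDirections s₀))).const_smul δ)))
        fun x => hminus t x _
  have hLint : Integrable L Q := integrable_of_continuous_of_compact Q hLcont
  have hgcont : ∀ t, Continuous (g t) := fun t =>
    (continuous_gradEstimator (hLip t t.2) hδ0 (hWcont t t.2) (fun x => hball _ (hWmem t x))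
      (continuous_apply t)).inner ((hWcont t t.2).sub continuous_const)
  have hgint : ∀ t, Integrable (g t) Q := fun t =>
    integrable_of_continuous_of_compact Q (hgcont t)
  have hround : ∀ t : Finset.Icc 1 T,
      ∫ x, (f t (W t x) - f t (z t) - 2 * (G * δ)) ∂Q ≤ ∫ x, g t x ∂Q := fun t =>
    integral_sub_le_integral_inner_gradEstimator hd (hconv t t.2) (hLip t t.2) hδ0 (hWcont t t.2)
      t (hWupd t t.2) (fun x => hball _ (hWmem t x)) (hball _ (hz t t.2))
  have hsum : ∀ x, ∑ t, g t x ≤ √((r ^ 2 + 2 * r * B) * (G : ℝ) ^ 2 * (d : ℝ) ^ 2 * T) := by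
    intro x
    have hdesc := sum_inner_le_of_descent (w := fun t => W t x) (z := z) (r := r) (D := d * G)
      (g := fun t => gradEstimator δ (f t) (W t x) (extendDirections s₀ x t))
      (η := η) hT
      (fun t ht => by
        simp only [W]
        rw [iterate_succ (Finset.mem_Icc.1 ht).1]
        exact norm_proj_sub_le (hKconv.smul _) hC ⟨_, hz t ht⟩ _ (hz t ht))
      (fun t ht => norm_gradEstimator_le (hLip t ht) hδ0 (hball _ (hWmem t x)) _)
      (fun t ht => hnear t ht _ (hWmem t x)) (fun t ht => hnear t ht _ (hWmem (t + 1) x))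
    have hsum_eq : ∑ t, g t x = ∑ t ∈ Finset.Icc 1 T,
        ⟪gradEstimator δ (f t) (W t x) (extendDirections s₀ x t), W t x - z t⟫ := by
      rw [← Finset.sum_coe_sort (Finset.Icc 1 T)]
      exact Finset.sum_congr rfl fun t _ => by rw [extendDirections_of_mem t.2]
    rw [hsum_eq, show (r ^ 2 + 2 * r * B) * (G : ℝ) ^ 2 * (d : ℝ) ^ 2 * T =
      (r ^ 2 + 2 * r * B) * (T * (G : ℝ) ^ 2 * (d : ℝ) ^ 2) by ring]
    refine le_sqrt_mul_of_two_mul_le (by positivity) (by positivity) hη ?_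
    have h1 : 2 * r * ∑ t ∈ Finset.Ico 1 T, ‖z t - z (t + 1)‖ ≤ 2 * r * B := by gcongr
    have h2 := sq_nonneg ‖W (T + 1) x - z T‖
    have h3 : (T : ℝ) * (η ^ 2 * (d * G) ^ 2) = η ^ 2 * (T * (G : ℝ) ^ 2 * (d : ℝ) ^ 2) := by ring
    linarith
  have hloss : ∀ x, L x - ∑ t ∈ Finset.Icc 1 T, f t (wstar t) ≤
      ∑ t : Finset.Icc 1 T, (f t (W t x) - f t (z t) - 2 * (G * δ)) + G * (3 * R₁ + R₂) := by
    intro x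
    -- In `3 * (G * δ)`, one part pays for playing `w_t ± δ u_t` instead of `w_t` and two offset the
    -- estimator's bias; `G * (ξ * R₂)` pays for `z t` in place of `wstar t`.
    have hterm : ∀ t ∈ Finset.Icc 1 T, (1 / 2 : ℝ) *
        (f t (W t x + δ • (extendDirections s₀ x t : EuclideanSpace ℝ (Fin d))) +
          f t (W t x - δ • (extendDirections s₀ x t : EuclideanSpace ℝ (Fin d)))) -
        f t (wstar t) ≤ (f t (W t x) - f t (z t) - 2 * (G * δ)) +
          (3 * (G * δ) + G * (ξ * R₂)) := by
      intro t ht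
      have hv : ‖(extendDirections s₀ x t : EuclideanSpace ℝ (Fin d))‖ = 1 := by simp
      have hnorm : ‖δ • (extendDirections s₀ x t : EuclideanSpace ℝ (Fin d))‖ = δ := by
        rw [norm_smul, hv, mul_one, Real.norm_eq_abs, abs_of_pos hδ0]
      have h1 := (le_abs_self _).trans
        ((hLip t ht).dist_le_mul _ (hplus t x (extendDirections s₀ x t)) _ (hself _ (hWmem t x)))
      have h2 := (le_abs_self _).trans
        ((hLip t ht).dist_le_mul _ (hminus t x (extendDirections s₀ x t)) _ (hself _ (hWmem t x)))
      have h3 := (le_abs_self _).trans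
        ((hLip t ht).dist_le_mul _ (hself _ (hz t ht)) _ (hwstar t ht).1)
      rw [dist_eq_norm, add_sub_cancel_left, hnorm] at h1
      rw [dist_eq_norm, sub_sub_cancel_left, norm_neg, hnorm] at h2
      have h4 : ‖z t - wstar t‖ ≤ ξ * R₂ := by
        have : z t - wstar t = -(ξ • wstar t) := by simp only [z]; module
        rw [this, norm_neg, norm_smul, Real.norm_eq_abs, abs_of_pos hξ0]
        gcongr
        simpa using hKR₂ (hwstar t ht).1
      have h5 : (G : ℝ) * ‖z t - wstar t‖ ≤ G * (ξ * R₂) := by gcongr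
      rw [dist_eq_norm] at h3
      linarith
    have hall := Finset.sum_le_sum hterm
    rw [Finset.sum_sub_distrib, Finset.sum_add_distrib, Finset.sum_const, Nat.card_Icc,
      nsmul_eq_mul] at hall
    have hTξ : (T : ℝ) * ξ = 1 := by rw [hξ]; field_simp
    have hconst : ((T + 1 - 1 : ℕ) : ℝ) * (3 * (G * δ) + G * (ξ * R₂)) = G * (3 * R₁ + R₂) := by
      rw [Nat.add_sub_cancel, hδ]
      linear_combination G * (3 * R₁ + R₂) * hTξ
    rw [hconst, ← Finset.sum_coe_sort (Finset.Icc 1 T) fun t =>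
      f t (W t x) - f t (z t) - 2 * (G * δ)] at hall
    exact hall
  have hfint : ∀ t : Finset.Icc 1 T,
      Integrable (fun x => f t (W t x) - f t (z t) - 2 * (G * δ)) Q := fun t =>
    integrable_of_continuous_of_compact Q
      (((hfcont t t.2 (hWcont t t.2) fun x => hself _ (hWmem t x)).sub continuous_const).sub
        continuous_const)
  simp only [hL]
  have hcomp : ∫ s, L (fun t => u t s) ∂P = ∫ x, L x ∂Q := by
    rw [← hQ.map_eq, integral_map hQ.aemeasurable hLcont.aestronglyMeasurable]
  refine ⟨?_, ?_⟩
  · rw [← hQ.map_eq] at hLint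
    exact hLint.comp_aemeasurable hQ.aemeasurable
  rw [hcomp]
  have e1 := integral_mono (hLint.sub (integrable_const (∑ t ∈ Finset.Icc 1 T, f t (wstar t))))
    ((integrable_finsetSum _ fun t _ => hfint t).add (integrable_const (G * (3 * R₁ + R₂)))) hloss
  have e2 := integral_mono (integrable_finsetSum Finset.univ fun t _ => hgint t)
    (integrable_const _) hsum
  have e3 := Finset.sum_le_sum fun t (_ : t ∈ Finset.univ) => hround t
  simp only [Pi.sub_apply, Pi.add_apply] at e1
  rw [integral_sub hLint (integrable_const _),
    integral_add (integrable_finsetSum _ fun t _ => hfint t) (integrable_const _),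
    integral_finsetSum _ fun t _ => hfint t] at e1
  rw [integral_finsetSum _ fun t _ => hgint t] at e2
  simp only [integral_const, probReal_univ, one_smul] at e1 e2
  linarith
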